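/- For a non-integer real number $\beta>1$ let $\tau_\beta:[0,1]\to[0,1]$, $\tau_\beta(x)=1-\{\beta x\}$, be the negative $\beta$-transformation, where $\{y\}$ is the fractional part of $y$. Call $\beta$ an *Yrrap number* if the orbit $\{\tau_\beta^n(1):n\ge 0\}$ is finite, and a *simple* Yrrap number if moreover $\tau_\beta^n(1)\in EP_\beta:=\{1/\beta,2/\beta,\dots,\lfloor\beta\rfloor/\beta\}$ for some $n\ge1$. Yrrap numbers are algebraic; by a Galois conjugate of $\beta$ we mean a complex root, different from $\beta$, of the minimal polynomial of $\beta$ over $\mathbb{Q}$. Put $d_n=1+\lfloor\beta\,\tau_\beta^n(1)\rfloor$ and define the power series $$\phi_\beta(z)=\sum_{n=0}^{\infty}(-1)^n d_n z^{n+1}$$ if $\tau_\beta^n(1)\notin EP_\beta$ for all $n\ge1$, and otherwise $$\phi_\beta(z)=\sum_{n=0}^{N-1}(-1)^n d_n z^{n+1}+(-1)^N\beta\,\tau_\beta^N(1)\,z^{N+1},\qquad N=\min\{n\ge1:\tau_\beta^n(1)\in EP_\beta\}.$$ By a zero of $1-\phi_\beta$ we mean a point $z\in\mathbb{C}$ at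 which the power series converges and $1-\phi_\beta(z)=0$, or, if the series is the expansion at $0$ of a rational function, a zero of the rational function that extends $1-\phi_\beta$. The point $1/\beta$ is always such a zero. Let $\mathbb{D}$ be the open unit disk in $\mathbb{C}$ and let $\mathcal{G}_{[0,1]}$ be the set of all $z\in\mathbb{D}$ for which there are $a_1,a_2,\dots\in[0,1]$ with $1+\sum_{n\ge1}a_nz^n=0$. Let * $\Phi$ be the closure in $\mathbb{C}$ of the set of all Galois conjugates of simple Yrrap numbers, * $\hat\Phi$ be the closure of the set of all Galois conjugates of Yrrap numbers, * $\Phi^*$ be the closure of the set of all $z^{-1}$, where $z\ne1/\beta$ is a zero of $1-\phi_\beta$ for some non-integer $\beta>1$. Then $$\Phi=\hat\Phi=\Phi^*=\overline{\mathbb{D}}\cup\{-z^{-1}: z\in\mathcal{G}_{[0,1]}\}.$$ -/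

import Mathlib

open scoped Pointwise

noncomputable section

namespace GenBeta

/-- The bases under consideration: non-integer real numbers `β > 1`. -/
def IsBase (β : ℝ) : Prop := 1 < β ∧ ∀ k : ℤ, β ≠ k

/-- `I_β(x) = [βx]`, for `x ∈ [0,1]`. -/
def branch (β x : ℝ) : ℕ := ⌊β * x⌋₊

/-- The map `τ_{β,E}(x) = E(I_β(x)) + (-1)^{E(I_β(x))} {βx}`, which sends `[0,1]` to itself.
Only its values on `[0,1]` matter below. -/
def tau (β : ℝ) (E : ℕ → Fin 2) (x : ℝ) : ℝ :=
  ((E (branch β x) : ℕ) : ℝ) + (-1) ^ (E (branch β x) : ℕ) * Int.fract (β * x)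

/-- The `n`-th point `τ_{β,E}^n(1)` of the orbit of `1`. -/
def orbitPt (β : ℝ) (E : ℕ → Fin 2) (n : ℕ) : ℝ := (tau β E)^[n] 1

/-- The digit `d_n(β,E,1)`. -/
def digit (β : ℝ) (E : ℕ → Fin 2) (n : ℕ) : ℕ :=
  (E (branch β (orbitPt β E n)) : ℕ) + branch β (orbitPt β E n)

/-- The sign `e_n(β,E,1)`. -/
def sgn (β : ℝ) (E : ℕ → Fin 2) (n : ℕ) : ℤ :=
  (-1) ^ (E (branch β (orbitPt β E n)) : ℕ)

/-- The cumulative sign `s_n(β,E,1)`. -/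
def cumSgn (β : ℝ) (E : ℕ → Fin 2) (n : ℕ) : ℤ :=
  ∏ i ∈ Finset.range n, sgn β E i

/-- The interior end points `1/β, …, [β]/β` of the monotone pieces. -/
def endPts (β : ℝ) : Set ℝ := {x | ∃ k : ℕ, 1 ≤ k ∧ k ≤ ⌊β⌋₊ ∧ x = k / β}

/-- The positive times at which the orbit of `1` is in `EP`. -/
def hitTimes (β : ℝ) (E : ℕ → Fin 2) : Set ℕ :=
  {n | 1 ≤ n ∧ orbitPt β E n ∈ endPts β}

/-- The orbit of `1` eventually falls to `EP`. -/
def IsSimple (β : ℝ) (E : ℕ → Fin 2) : Prop := (hitTimes β E).Nonempty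

/-- `β` is a generalized Parry number with respect to `E`: the orbit of `1` is a finite set. -/
def IsGenParry (β : ℝ) (E : ℕ → Fin 2) : Prop :=
  IsBase β ∧ (Set.range (orbitPt β E)).Finite

/-- `β` is a simple generalized Parry number with respect to `E`. -/
def IsSimpleGenParry (β : ℝ) (E : ℕ → Fin 2) : Prop :=
  IsGenParry β E ∧ IsSimple β E

/-- The Galois conjugates of `β` in `ℂ`, other than `β` itself. -/
def galoisConjugates (β : ℝ) : Set ℂ :=
  {z | z ∈ (minpoly ℚ β).rootSet ℂ ∧ z ≠ (β : ℂ)}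

/-- `Φ(E)`. -/
def Phi (E : ℕ → Fin 2) : Set ℂ :=
  closure {z | ∃ β : ℝ, IsSimpleGenParry β E ∧ z ∈ galoisConjugates β}

/-- `Φ̂(E)`. -/
def PhiHat (E : ℕ → Fin 2) : Set ℂ :=
  closure {z | ∃ β : ℝ, IsGenParry β E ∧ z ∈ galoisConjugates β}

open Classical in
/-- The power series `φ_{τ_{β,E}}`. In the simple case it is a polynomial of degree `N + 1`, with
`N = sInf (hitTimes β E)` the first time `n ≥ 1` at which the orbit of `1` is in `EP`. -/
def phi (β : ℝ) (E : ℕ → Fin 2) : PowerSeries ℝ :=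
  PowerSeries.mk fun m =>
    match m with
    | 0 => 0
    | n + 1 =>
      if IsSimple β E then
        if n < sInf (hitTimes β E) then (cumSgn β E n : ℝ) * digit β E n
        else if n = sInf (hitTimes β E) then β * orbitPt β E n * cumSgn β E n
        else 0
      else (cumSgn β E n : ℝ) * digit β E n

/-- The power series `f` converges at `z`, and its sum there is `0`. -/
def SumsToZeroAt (f : PowerSeries ℝ) (z : ℂ) : Prop :=
  HasSum (fun n : ℕ => ((PowerSeries.coeff n f : ℝ) : ℂ) * z ^ n) 0

/-- `f` is the expansion at `0` of a rational function `P / Q` which has a zero at `z`. -/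
def RationalExtensionVanishesAt (f : PowerSeries ℝ) (z : ℂ) : Prop :=
  ∃ P Q : Polynomial ℝ, (Q : PowerSeries ℝ) * f = (P : PowerSeries ℝ) ∧
    Polynomial.aeval z Q ≠ 0 ∧ Polynomial.aeval z P = 0

/-- `z` is a zero of `f`, where `f` is regarded as a function on its domain of convergence and,
if it is the expansion of a rational function, on the domain of that function. -/
def IsZeroOf (f : PowerSeries ℝ) (z : ℂ) : Prop :=
  SumsToZeroAt f z ∨ RationalExtensionVanishesAt f z

/-- `Φ*(E)`: the closure of the set of inverses of the zeros of `1 - φ_{τ_{β,E}}`, for all `β`,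
other than the zero `1/β` that is always there. -/
def PhiStar (E : ℕ → Fin 2) : Set ℂ :=
  closure {w | ∃ β : ℝ, IsBase β ∧ ∃ z : ℂ,
    IsZeroOf (1 - phi β E) z ∧ z ≠ (β : ℂ)⁻¹ ∧ w = z⁻¹}

/-- `𝓕_I`: the power series with constant term `1` and all other coefficients in `I`. -/
def seriesClass (I : Set ℝ) : Set (PowerSeries ℝ) :=
  {f | PowerSeries.coeff 0 f = 1 ∧ ∀ n : ℕ, 1 ≤ n → PowerSeries.coeff n f ∈ I}

/-- `𝓖_I`: the zeros in the open unit disk of the power series in `𝓕_I`. -/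
def zeroSet (I : Set ℝ) : Set ℂ :=
  {z | z ∈ Metric.ball (0 : ℂ) 1 ∧ ∃ f ∈ seriesClass I, SumsToZeroAt f z}

/-- `E_1 = (1, 1, 1, …)`; the maps `τ_{β,E_1}` are the negative `β`-transformations
`x ↦ 1 - {βx}`. -/
def E₁ : ℕ → Fin 2 := fun _ => 1

end GenBeta

end

namespace GenBeta

open Polynomial

/-! ### The negative `β`-transformation and the orbit of `1` -/

/-! Write `x n` for the orbit of `1`. Since `d n = β * x n + x (n + 1)`, the function `1 - φ`
factors as `1 - β z` times `∑ (-1)^n a n z^n`, where `a n ∈ [0,1]`, `a 0 = 1`, and `a` is the orbit,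
cut off at the first hit of an end point if there is one. A zero other than `1/β` inside the unit
disk is therefore the negative of a point of `𝓖_{[0,1]}`. For a conjugate `γ` outside the closed
disk, the conjugated orbit satisfies the same recursion and takes finitely many values; comparing
both recursions at `-γ⁻¹` shows that `∑ x n z^n` vanishes there. The limit set is closed by
compactness of the coefficient space, so it contains all three closures.

For the converse it is enough to reach the limit set with simple numbers
(`neg_inv_mem_Phi_of_polynomial_zero`). A polynomial with constant term `1` and coefficients in
`[0,1]` is approximated by scaled integer polynomials whose coefficients are the digits of a simple
Yrrap number. Digits congruent to `2` mod `4` give irreducibility by Eisenstein, so every other root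
is a Galois conjugate, and Hurwitz's theorem carries the zeros along. Truncating power series yields
`𝓖_{[0,1]}`. The disk is filled because a nonreal `v` in it with rational angle is a root of a monic
polynomial with coefficients in `[0,1]`. -/

theorem tau_E₁ (β x : ℝ) : tau β E₁ x = 1 - Int.fract (β * x) := by
  simp [tau, E₁]; ring

theorem orbitPt_zero (β : ℝ) (E : ℕ → Fin 2) : orbitPt β E 0 = 1 := rfl

theorem orbitPt_succ (β : ℝ) (E : ℕ → Fin 2) (n : ℕ) :
    orbitPt β E (n + 1) = tau β E (orbitPt β E n) :=
  Function.iterate_succ_apply' _ _ _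

theorem orbitPt_mem_Icc (β : ℝ) (n : ℕ) : orbitPt β E₁ n ∈ Set.Icc (0 : ℝ) 1 := by
  cases n with
  | zero => simp [orbitPt_zero]
  | succ n =>
    rw [orbitPt_succ, tau_E₁]
    have h₀ := Int.fract_nonneg (β * orbitPt β E₁ n)
    have h₁ := Int.fract_lt_one (β * orbitPt β E₁ n)
    constructor <;> linarith

theorem cumSgn_E₁ (β : ℝ) (n : ℕ) : cumSgn β E₁ n = (-1) ^ n := by
  simp [cumSgn, sgn, E₁]

/-- The digit is `⌊β x⌋ + 1` and the next point is `1 - {β x}`. This recursion is the only dynamical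
input to the upper bounds. -/
theorem digit_eq {β : ℝ} (hβ : 0 ≤ β) (n : ℕ) :
    (digit β E₁ n : ℝ) = β * orbitPt β E₁ n + orbitPt β E₁ (n + 1) := by
  have h : 0 ≤ β * orbitPt β E₁ n := mul_nonneg hβ (orbitPt_mem_Icc β n).1
  rw [orbitPt_succ, tau_E₁, Int.fract, ← natCast_floor_eq_intCast_floor h]
  simp [digit, branch, E₁]
  ring

/-- If the orbit of `1` meets an interior end point then it returns to `1`, hence is finite. -/
theorem finite_range_orbitPt_of_isSimple {β : ℝ} (hβ : 0 < β) (h : IsSimple β E₁) :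
    (Set.range (orbitPt β E₁)).Finite := by
  obtain ⟨N, -, k, -, -, hk⟩ := h
  have hper : Function.IsPeriodicPt (tau β E₁) (N + 1) 1 := by
    change orbitPt β E₁ (N + 1) = 1
    rw [orbitPt_succ, hk, tau_E₁, mul_div_cancel₀ _ hβ.ne']
    simp
  refine ((Finset.range (N + 1)).image (orbitPt β E₁)).finite_toSet.subset ?_
  rintro _ ⟨n, rfl⟩
  simp only [Finset.coe_image, Set.mem_image, Finset.coe_range, Set.mem_Iio]
  exact ⟨n % (N + 1), Nat.mod_lt _ N.succ_pos, hper.iterate_mod_apply n⟩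

/-! ### Conjugating the orbit of `1` -/

theorem aeval_eq_zero_of_mem_rootSet_minpoly {β : ℝ} {γ : ℂ}
    (hγ : γ ∈ (minpoly ℚ β).rootSet ℂ) {P : ℚ[X]} (hP : aeval β P = 0) : aeval γ P = 0 := by
  obtain ⟨Q, rfl⟩ := minpoly.dvd ℚ β hP
  rw [map_mul, (mem_rootSet.1 hγ).2, zero_mul]

/-- The conjugate of the orbit of `1` under the embedding `β ↦ γ`. -/
theorem exists_conjugate_orbit {β : ℝ} (hβ : 0 ≤ β) {γ : ℂ}
    (hγ : γ ∈ (minpoly ℚ β).rootSet ℂ) :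
    ∃ y : ℕ → ℂ, y 0 = 1 ∧ (∀ n, (digit β E₁ n : ℂ) = γ * y n + y (n + 1)) ∧
      (∀ i j, orbitPt β E₁ i = orbitPt β E₁ j → y i = y j) ∧
      ∀ n k : ℕ, β * orbitPt β E₁ n = k → γ * y n = k := by
  -- The recursion, solved for the next point with the digits kept as constants, makes each orbit
  -- point a rational polynomial in `β`. Evaluating these at `γ` gives the conjugate orbit.
  let A : ℕ → ℚ[X] := fun n => Nat.rec 1 (fun n P => C (digit β E₁ n : ℚ) - X * P) n
  have hA : ∀ n, A (n + 1) = C (digit β E₁ n : ℚ) - X * A n := fun n => rfl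
  have hx : ∀ n, aeval β (A n) = orbitPt β E₁ n := by
    intro n
    induction n with
    | zero => simp [A, orbitPt_zero]
    | succ n ih =>
      rw [hA, map_sub, map_mul, ih, aeval_X, aeval_C, map_natCast, digit_eq hβ]
      ring
  refine ⟨fun n => aeval γ (A n), by simp [A], fun n => ?_, fun i j hij => ?_, fun n k hk => ?_⟩
  · simp [hA]
  · have := aeval_eq_zero_of_mem_rootSet_minpoly hγ (P := A i - A j) (by
      rw [map_sub, hx, hx, hij, sub_self])
    rwa [map_sub, sub_eq_zero] at this
  · have := aeval_eq_zero_of_mem_rootSet_minpoly hγ (P := X * A n - C (k : ℚ)) (by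
      rw [map_sub, map_mul, hx, aeval_X, hk]; simp)
    rw [map_sub, map_mul, aeval_X, sub_eq_zero] at this
    simpa using this

/-- Summation of the recursion `d_n = γ y_n + y_{n+1}` with weights `ζ^{n+1}`. -/
theorem one_add_sum_eq {d y : ℕ → ℂ} {γ : ℂ} (h₀ : y 0 = 1)
    (h : ∀ n, d n = γ * y n + y (n + 1)) (ζ : ℂ) (N : ℕ) :
    1 + ∑ n ∈ Finset.range N, d n * ζ ^ (n + 1) =
      (1 + γ * ζ) * ∑ n ∈ Finset.range N, y n * ζ ^ n + y N * ζ ^ N := by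
  induction N with
  | zero => simp [h₀]
  | succ N ih =>
    rw [Finset.sum_range_succ, ← add_assoc, ih, Finset.sum_range_succ, h]
    ring

/-! ### The zero set in the unit disk -/

theorem summable_mul_pow {a : ℕ → ℂ} {C : ℝ} (ha : ∀ n, ‖a n‖ ≤ C) {z : ℂ} (hz : ‖z‖ < 1) :
    Summable fun n => ‖a n * z ^ n‖ := by
  refine Summable.of_nonneg_of_le (fun n => norm_nonneg _) (fun n => ?_)
    ((summable_geometric_of_lt_one (norm_nonneg z) hz).mul_left C)
  rw [norm_mul, norm_pow]
  gcongr
  exact ha n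

theorem norm_ofReal_le_one_of_mem_Icc {a : ℝ} (ha : a ∈ Set.Icc (0 : ℝ) 1) : ‖(a : ℂ)‖ ≤ 1 := by
  rw [Complex.norm_real, Real.norm_of_nonneg ha.1]
  exact ha.2

theorem mem_zeroSet_iff {z : ℂ} :
    z ∈ zeroSet (Set.Icc (0 : ℝ) 1) ↔ ‖z‖ < 1 ∧ ∃ a : ℕ → ℝ, a 0 = 1 ∧
      (∀ n, a n ∈ Set.Icc (0 : ℝ) 1) ∧ HasSum (fun n => (a n : ℂ) * z ^ n) 0 := by
  rw [zeroSet, Set.mem_ofPred_eq, mem_ball_zero_iff]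
  refine and_congr_right fun _ => ⟨?_, ?_⟩
  · rintro ⟨f, ⟨h₀, h₁⟩, hf⟩
    refine ⟨fun n => PowerSeries.coeff n f, h₀, fun n => ?_, hf⟩
    rcases Nat.eq_zero_or_pos n with rfl | hn
    · simp [h₀]
    · exact h₁ n hn
  · rintro ⟨a, h₀, h₁, ha⟩
    exact ⟨PowerSeries.mk a, ⟨by simpa using h₀, fun n _ => by simpa using h₁ n⟩,
      by simpa [SumsToZeroAt] using ha⟩

theorem mem_neg_inv_zeroSet_iff {w : ℂ} :
    w ∈ -(zeroSet (Set.Icc (0 : ℝ) 1))⁻¹ ↔ -w⁻¹ ∈ zeroSet (Set.Icc (0 : ℝ) 1) := by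
  rw [Set.mem_neg, Set.mem_inv, inv_neg]

theorem mem_limitSet_of_norm_le_one {w : ℂ} (hw : ‖w‖ ≤ 1) :
    w ∈ closure (Metric.ball (0 : ℂ) 1) ∪ -(zeroSet (Set.Icc (0 : ℝ) 1))⁻¹ := by
  left
  rw [closure_ball _ one_ne_zero]
  simpa using hw

/-- Galois conjugates of generalized Parry numbers lie in the limit set. -/
theorem galoisConjugate_mem_limitSet {β : ℝ} (hβ : IsGenParry β E₁) {γ : ℂ}
    (hγ : γ ∈ galoisConjugates β) :
    γ ∈ closure (Metric.ball (0 : ℂ) 1) ∪ -(zeroSet (Set.Icc (0 : ℝ) 1))⁻¹ := by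
  rcases le_or_gt ‖γ‖ 1 with h | h
  · exact mem_limitSet_of_norm_le_one h
  have hβ₀ : 0 ≤ β := by linarith [hβ.1.1]
  have hγ₀ : γ ≠ 0 := norm_pos_iff.1 (by linarith)
  obtain ⟨y, hy₀, hy, hxy, -⟩ := exists_conjugate_orbit hβ₀ hγ.1
  set x : ℕ → ℂ := fun n => (orbitPt β E₁ n : ℂ) with hxdef
  have hx : ∀ n, (digit β E₁ n : ℂ) = β * x n + x (n + 1) := fun n => by
    simpa using congrArg Complex.ofReal (digit_eq hβ₀ n)
  have hxn : ∀ n, ‖x n‖ ≤ 1 := fun n => norm_ofReal_le_one_of_mem_Icc (orbitPt_mem_Icc β n)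
  have hyfin : (Set.range y).Finite := by
    have hfac : Function.FactorsThrough y (orbitPt β E₁) := fun i j hij => hxy i j hij
    rw [← hfac.extend_comp (0 : ℝ → ℂ), Set.range_comp]
    exact hβ.2.image _
  obtain ⟨C, hC⟩ := hyfin.isBounded.exists_norm_le
  set ζ : ℂ := -γ⁻¹ with hζ
  have hζ₁ : ‖ζ‖ < 1 := by
    rw [hζ, norm_neg, norm_inv]
    exact inv_lt_one_of_one_lt₀ h
  have hγζ : 1 + γ * ζ = 0 := by rw [hζ]; field_simp; ring
  have hβζ : 1 + (β : ℂ) * ζ ≠ 0 := by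
    intro h0
    apply hγ.2
    have : (γ - β) * ζ = 0 := by linear_combination hγζ - h0
    rcases mul_eq_zero.1 this with h1 | h1
    · exact sub_eq_zero.1 h1
    · rw [hζ] at h1; simp [hγ₀] at h1
  have hsum : Summable fun n => x n * ζ ^ n := (summable_mul_pow hxn hζ₁).of_norm
  have hlim : Filter.Tendsto (fun N => (y N - x N) * ζ ^ N) Filter.atTop (nhds 0) := by
    have := (summable_mul_pow (a := fun n => y n - x n) (C := C + 1) (fun n =>
      (norm_sub_le _ _).trans (add_le_add (hC _ ⟨n, rfl⟩) (hxn n))) hζ₁).of_norm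
    exact this.tendsto_atTop_zero
  -- Both orbits share the same digits, and at `ζ` the factor `1 + γ ζ` vanishes; only boundary
  -- terms survive, and these tend to `0`.
  have key : ∀ N, (1 + (β : ℂ) * ζ) * ∑ n ∈ Finset.range N, x n * ζ ^ n =
      (y N - x N) * ζ ^ N := by
    intro N
    have h1 := one_add_sum_eq (d := fun n => (digit β E₁ n : ℂ)) hy₀ hy ζ N
    have h2 := one_add_sum_eq (d := fun n => (digit β E₁ n : ℂ)) (by simp [hxdef, orbitPt_zero])
      hx ζ N
    rw [hγζ] at h1
    linear_combination h1 - h2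
  have hzero : (1 + (β : ℂ) * ζ) * ∑' n, x n * ζ ^ n = 0 := by
    refine tendsto_nhds_unique (hsum.hasSum.tendsto_sum_nat.const_mul _) ?_
    simpa only [key] using hlim
  right
  rw [mem_neg_inv_zeroSet_iff, mem_zeroSet_iff]
  refine ⟨hζ₁, orbitPt β E₁, rfl, orbitPt_mem_Icc β, ?_⟩
  have := hsum.hasSum
  rwa [(mul_eq_zero.1 hzero).resolve_left hβζ] at this

/-! ### Zeros of `1 - φ` -/

/-- Evaluation of the product of a polynomial and a power series with bounded coefficients. -/
theorem hasSum_coeff_polynomial_mul {g : PowerSeries ℝ} {C : ℝ}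
    (hg : ∀ n, |PowerSeries.coeff n g| ≤ C) (Q : ℝ[X]) {z : ℂ} (hz : ‖z‖ < 1) :
    HasSum (fun n => ((PowerSeries.coeff n ((Q : PowerSeries ℝ) * g) : ℝ) : ℂ) * z ^ n)
      (aeval z Q * ∑' n, ((PowerSeries.coeff n g : ℝ) : ℂ) * z ^ n) := by
  have hgs := summable_mul_pow (a := fun n => ((PowerSeries.coeff n g : ℝ) : ℂ)) (C := C)
    (by simpa using hg) hz
  induction Q using Polynomial.induction_on' with
  | add P Q hP hQ =>
    simpa [add_mul] using hP.add hQ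
  | monomial k a =>
    have hmon : ((monomial k a : ℝ[X]) : PowerSeries ℝ) * g =
        PowerSeries.C a * (PowerSeries.X ^ k * g) := by
      rw [← C_mul_X_pow_eq_monomial, Polynomial.coe_mul, Polynomial.coe_C, Polynomial.coe_pow,
        Polynomial.coe_X, mul_assoc]
    rw [aeval_monomial, hmon, ← hasSum_nat_add_iff' k]
    have h0 : ∑ i ∈ Finset.range k, ((PowerSeries.coeff i
        (PowerSeries.C a * (PowerSeries.X ^ k * g)) : ℝ) : ℂ) * z ^ i = 0 := by
      refine Finset.sum_eq_zero fun i hi => ?_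
      rw [PowerSeries.coeff_C_mul, PowerSeries.coeff_X_pow_mul', if_neg (by simpa using hi)]
      simp
    rw [h0, sub_zero]
    refine (congrArg (HasSum · _) (funext fun n => ?_)).mpr
      (hgs.of_norm.hasSum.mul_left (algebraMap ℝ ℂ a * z ^ k))
    rw [PowerSeries.coeff_C_mul, PowerSeries.coeff_X_pow_mul, pow_add, Complex.ofReal_mul,
      Complex.coe_algebraMap]
    ring

/-- `1 - φ` is the product of `1 - βz` and a series whose coefficients have absolute value at
most `1` and alternating signs. -/
theorem exists_one_sub_phi_eq_mul {β : ℝ} (hβ : 0 ≤ β) :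
    ∃ a : ℕ → ℝ, a 0 = 1 ∧ (∀ n, a n ∈ Set.Icc (0 : ℝ) 1) ∧
      1 - phi β E₁ = ((1 - C β * X : ℝ[X]) : PowerSeries ℝ) *
        PowerSeries.mk fun n => (-1) ^ n * a n := by
  classical
  set N := sInf (hitTimes β E₁) with hN
  -- In the simple case the last coefficient is `β x_N` without the summand `x_{N+1}`, so the orbit
  -- is replaced by `0` from index `N + 1` on.
  refine ⟨fun n => if IsSimple β E₁ ∧ N < n then 0 else orbitPt β E₁ n, by simp [orbitPt_zero],
    fun n => ?_, ?_⟩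
  · dsimp only
    split_ifs
    · simp
    · exact orbitPt_mem_Icc β n
  · ext m
    rw [Polynomial.coe_sub, Polynomial.coe_mul, Polynomial.coe_C, Polynomial.coe_X,
      Polynomial.coe_one, sub_mul, one_mul, mul_assoc, map_sub, map_sub, PowerSeries.coeff_C_mul]
    cases m with
    | zero => simp [phi, orbitPt_zero]
    | succ n =>
      rw [PowerSeries.coeff_succ_X_mul, PowerSeries.coeff_one, if_neg n.succ_ne_zero, phi]
      simp only [PowerSeries.coeff_mk, ← hN, cumSgn_E₁, digit_eq hβ]
      by_cases hs : IsSimple β E₁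
      · rcases lt_trichotomy n N with h | h | h
        · simp only [hs, h, if_true, true_and, if_neg (show ¬ N < n + 1 by omega),
            if_neg (show ¬ N < n by omega)]
          push_cast
          ring
        · simp only [hs, h, if_true, true_and, lt_irrefl, if_false, Nat.lt_succ_self]
          push_cast
          ring
        · simp only [hs, h, if_true, true_and, if_neg (show ¬ n < N by omega),
            if_neg (show ¬ n = N by omega), if_pos (show N < n + 1 by omega)]
          ring
      · simp only [hs, if_false, false_and]
        push_cast
        ring

/-- Inverses of zeros of `1 - φ` other than `1/β` lie in the limit set. -/
theorem inv_zero_mem_limitSet {β : ℝ} (hβ : IsBase β) {z : ℂ} (hz : IsZeroOf (1 - phi β E₁) z)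
    (hzβ : z ≠ (β : ℂ)⁻¹) :
    z⁻¹ ∈ closure (Metric.ball (0 : ℂ) 1) ∪ -(zeroSet (Set.Icc (0 : ℝ) 1))⁻¹ := by
  rcases le_or_gt 1 ‖z‖ with h | h
  · refine mem_limitSet_of_norm_le_one ?_
    rw [norm_inv]
    exact inv_le_one_of_one_le₀ h
  have hβ₁ := hβ.1
  obtain ⟨a, ha₀, ha, hφ⟩ := exists_one_sub_phi_eq_mul (β := β) (by linarith)
  set g : PowerSeries ℝ := PowerSeries.mk fun n => (-1) ^ n * a n with hg
  have hgb : ∀ n, |PowerSeries.coeff n g| ≤ 1 := fun n => by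
    rw [hg, PowerSeries.coeff_mk, abs_mul, abs_pow, abs_neg, abs_one, one_pow, one_mul,
      abs_of_nonneg (ha n).1]
    exact (ha n).2
  have hβz : aeval z (1 - C β * X : ℝ[X]) ≠ 0 := by
    simp only [map_sub, map_one, map_mul, aeval_C, aeval_X, Complex.coe_algebraMap]
    intro h0
    exact hzβ (eq_inv_of_mul_eq_one_right (sub_eq_zero.1 h0).symm)
  have hzero : ∑' n, ((PowerSeries.coeff n g : ℝ) : ℂ) * z ^ n = 0 := by
    rcases hz with hz | ⟨P, Q, hPQ, hQ, hP⟩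
    · rw [hφ] at hz
      exact (mul_eq_zero.1 ((hasSum_coeff_polynomial_mul hgb _ h).unique hz)).resolve_left hβz
    -- The identity `Q (1 - β X) g = P` of formal series can be evaluated at `z`, because `g`
    -- converges in the whole unit disk.
    · rw [hφ, ← mul_assoc, ← Polynomial.coe_mul] at hPQ
      have h1 := hasSum_coeff_polynomial_mul hgb (Q * (1 - C β * X)) h
      have h2 := hasSum_coeff_polynomial_mul (g := 1) (C := 1) (fun n => by
        rw [PowerSeries.coeff_one]; split_ifs <;> simp) P h
      rw [hPQ] at h1
      rw [mul_one, hP, zero_mul] at h2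
      have h3 := h1.unique h2
      rw [map_mul] at h3
      exact (mul_eq_zero.1 h3).resolve_left (mul_ne_zero hQ hβz)
  right
  rw [mem_neg_inv_zeroSet_iff, inv_inv, mem_zeroSet_iff]
  refine ⟨by rwa [norm_neg], a, ha₀, ha, ?_⟩
  have hs := (summable_mul_pow (a := fun n => ((PowerSeries.coeff n g : ℝ) : ℂ)) (C := 1)
    (by simpa using hgb) h).of_norm.hasSum
  rw [hzero] at hs
  refine (congrArg (HasSum · _) (funext fun n => ?_)).mpr hs
  rw [hg, PowerSeries.coeff_mk, neg_pow]
  push_cast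
  ring

/-- Inverses of Galois conjugates of simple generalized Parry numbers are zeros of `1 - φ`. -/
theorem isZeroOf_inv_galoisConjugate {β : ℝ} (hβ : IsSimpleGenParry β E₁) {γ : ℂ}
    (hγ : γ ∈ galoisConjugates β) : IsZeroOf (1 - phi β E₁) γ⁻¹ := by
  have hβ₀ : 0 < β := by linarith [hβ.1.1.1]
  obtain ⟨y, hy₀, hy, -, hyk⟩ := exists_conjugate_orbit hβ₀.le hγ.1
  have hs := hβ.2
  obtain ⟨-, k, hk₁, -, hk⟩ := Nat.sInf_mem hs
  set N := sInf (hitTimes β E₁) with hN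
  have hk' : β * orbitPt β E₁ N = k := by rw [hk]; field_simp
  -- The integer `β x_N = k` is fixed by conjugation, which yields the last coefficient of `φ`.
  have hγy := hyk N k hk'
  have hγ₀ : γ ≠ 0 := by
    rintro rfl
    rw [zero_mul] at hγy
    have : k = 0 := by exact_mod_cast hγy.symm
    omega
  left
  have hc : ∀ n, PowerSeries.coeff (n + 1) (1 - phi β E₁) =
      if n < N then -((-1) ^ n * (digit β E₁ n : ℝ)) else if n = N then -((-1) ^ n * k) else 0 := by
    intro n
    rw [map_sub, PowerSeries.coeff_one, if_neg n.succ_ne_zero, phi]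
    simp only [PowerSeries.coeff_mk, ← hN, cumSgn_E₁, hs, if_true]
    split_ifs with h1 h2
    · push_cast; ring
    · subst h2; rw [hk']; push_cast; ring
    · ring
  have hfin : HasSum (fun n => ((PowerSeries.coeff n (1 - phi β E₁) : ℝ) : ℂ) * γ⁻¹ ^ n)
      (∑ n ∈ Finset.range (N + 2),
        ((PowerSeries.coeff n (1 - phi β E₁) : ℝ) : ℂ) * γ⁻¹ ^ n) := by
    refine hasSum_sum_of_ne_finset_zero fun n hn => ?_
    obtain ⟨m, rfl⟩ : ∃ m, n = m + 1 := ⟨n - 1, by simp at hn; omega⟩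
    simp only [Finset.mem_range, not_lt] at hn
    rw [hc, if_neg (by omega), if_neg (by omega)]
    simp
  have hval : ∑ n ∈ Finset.range (N + 2),
        ((PowerSeries.coeff n (1 - phi β E₁) : ℝ) : ℂ) * γ⁻¹ ^ n = 0 := by
    have h1 := one_add_sum_eq (d := fun n => (digit β E₁ n : ℂ)) hy₀ hy (-γ⁻¹) N
    rw [mul_neg, mul_inv_cancel₀ hγ₀, add_neg_cancel, zero_mul, zero_add] at h1
    have h2 : ∑ n ∈ Finset.range N,
        ((PowerSeries.coeff (n + 1) (1 - phi β E₁) : ℝ) : ℂ) * γ⁻¹ ^ (n + 1) =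
        ∑ n ∈ Finset.range N, (digit β E₁ n : ℂ) * (-γ⁻¹) ^ (n + 1) := by
      refine Finset.sum_congr rfl fun n hn => ?_
      rw [hc, if_pos (Finset.mem_range.1 hn), neg_pow γ⁻¹]
      push_cast
      ring
    rw [Finset.sum_range_succ', Finset.sum_range_succ, h2, hc, if_neg (lt_irrefl N), if_pos rfl]
    have h3 : y N = k * γ⁻¹ := by rw [← hγy]; field_simp
    rw [h3, neg_pow] at h1
    simp only [phi, map_sub, PowerSeries.coeff_zero_one, PowerSeries.coeff_mk]
    push_cast
    linear_combination h1
  rwa [hval] at hfin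

end GenBeta

namespace GenBeta

open Filter Topology

/-! ### Persistence of zeros under uniform convergence -/

/-- Hurwitz's theorem: a zero of a limit that does not vanish identically near it is a limit of
zeros of the approximating functions. -/
theorem eventually_exists_zero_of_tendstoUniformlyOn {ι : Type*} {l : Filter ι}
    {F : ι → ℂ → ℂ} {f : ℂ → ℂ} {z₀ : ℂ} {r : ℝ} (hr : 0 < r)
    (hF : ∀ i, DifferentiableOn ℂ (F i) (Metric.ball z₀ r)) (hf : AnalyticAt ℂ f z₀)
    (hne : ¬ ∀ᶠ z in 𝓝 z₀, f z = 0) (h0 : f z₀ = 0)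
    (hlim : TendstoUniformlyOn F f l (Metric.ball z₀ r)) {ε : ℝ} (hε : 0 < ε) :
    ∀ᶠ i in l, ∃ z, dist z z₀ < ε ∧ F i z = 0 := by
  have hne' := hf.eventually_eq_zero_or_eventually_ne_zero.resolve_left hne
  rw [eventually_nhdsWithin_iff] at hne'
  obtain ⟨s, hs, hsf⟩ := Metric.eventually_nhds_iff.1 (hne'.and hf.eventually_analyticAt)
  obtain ⟨ρ, hρ, hρm⟩ : ∃ ρ, 0 < ρ ∧ ρ < min s (min r ε) :=
    exists_between (lt_min hs (lt_min hr hε))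
  have hρs : ρ < s := hρm.trans_le (min_le_left _ _)
  have hρr : ρ < r := hρm.trans_le ((min_le_right _ _).trans (min_le_left _ _))
  have hρε : ρ < ε := hρm.trans_le ((min_le_right _ _).trans (min_le_right _ _))
  have hcont : ContinuousOn (fun z => ‖f z‖) (Metric.sphere z₀ ρ) := fun z hz =>
    ((hsf (by rw [Metric.mem_sphere.1 hz]; exact hρs)).2.continuousAt.norm).continuousWithinAt
  obtain ⟨z₁, hz₁, hmin⟩ := (isCompact_sphere z₀ ρ).exists_isMinOn
    (NormedSpace.sphere_nonempty.2 hρ.le) hcont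
  set δ := ‖f z₁‖ / 2 with hδ
  have hδ₀ : 0 < δ := by
    refine half_pos (norm_pos_iff.2 ((hsf ?_).1 ?_))
    · rw [Metric.mem_sphere.1 hz₁]; exact hρs
    · rintro rfl
      simp [hρ.ne] at hz₁
  filter_upwards [Metric.tendstoUniformlyOn_iff.1 hlim δ hδ₀] with i hi
  -- On the circle `‖f‖ ≥ 2δ`, hence `‖F i‖ ≥ δ`. Without zeros, the maximum principle for `1 / F i`
  -- would force `‖F i z₀‖ ≥ δ`, although `F i z₀` is within `δ` of `f z₀ = 0`.
  by_contra! hno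
  have hsub : Metric.closedBall z₀ ρ ⊆ Metric.ball z₀ r := Metric.closedBall_subset_ball hρr
  have hd : DiffContOnCl ℂ (fun z => (F i z)⁻¹) (Metric.ball z₀ ρ) := by
    refine DifferentiableOn.diffContOnCl ?_
    rw [closure_ball _ hρ.ne']
    exact ((hF i).mono hsub).inv fun z hz => hno z ((Metric.mem_closedBall.1 hz).trans_lt hρε)
  have hfr : ∀ z ∈ frontier (Metric.ball z₀ ρ), ‖(F i z)⁻¹‖ ≤ δ⁻¹ := by
    intro z hz
    rw [frontier_ball _ hρ.ne'] at hz
    have h1 := hi z (hsub (Metric.sphere_subset_closedBall hz))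
    have h2 : ‖f z₁‖ ≤ ‖f z‖ := hmin hz
    rw [dist_eq_norm] at h1
    have h3 := norm_sub_norm_le (f z) (F i z)
    rw [norm_inv]
    exact inv_anti₀ hδ₀ (by linarith)
  have hctr := Complex.norm_le_of_forall_mem_frontier_norm_le Metric.isBounded_ball hd hfr
    (subset_closure (Metric.mem_ball_self hρ))
  have h1 := hi z₀ (Metric.mem_ball_self hr)
  rw [h0, dist_zero_left] at h1
  have h2 : 0 < ‖F i z₀‖ := norm_pos_iff.2 (hno z₀ (by simpa using hε))
  rw [norm_inv] at hctr
  exact absurd ((inv_le_inv₀ h2 hδ₀).1 hctr) (not_le.2 h1)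

theorem tendstoUniformlyOn_sum_mul_pow {ι : Type*} {l : Filter ι} {p : ι → ℕ → ℂ} {q : ℕ → ℂ}
    (N : ℕ) (h : ∀ n < N, Tendsto (fun i => p i n) l (𝓝 (q n))) (R : ℝ) :
    TendstoUniformlyOn (fun i z => ∑ n ∈ Finset.range N, p i n * z ^ n)
      (fun z => ∑ n ∈ Finset.range N, q n * z ^ n) l (Metric.closedBall (0 : ℂ) R) := by
  rw [Metric.tendstoUniformlyOn_iff]
  intro ε hε
  have hlim : Tendsto (fun i => ∑ n ∈ Finset.range N, ‖q n - p i n‖ * |R| ^ n) l (𝓝 0) := by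
    have : Tendsto (fun i => ∑ n ∈ Finset.range N, ‖q n - p i n‖ * |R| ^ n) l
        (𝓝 (∑ n ∈ Finset.range N, ‖q n - q n‖ * |R| ^ n)) :=
      tendsto_finsetSum _ fun n hn =>
        ((tendsto_const_nhds.sub (h n (Finset.mem_range.1 hn))).norm).mul_const _
    simpa using this
  filter_upwards [hlim.eventually (gt_mem_nhds hε)] with i hi z hz
  refine lt_of_le_of_lt ?_ hi
  rw [dist_eq_norm, ← Finset.sum_sub_distrib]
  refine (norm_sum_le _ _).trans (Finset.sum_le_sum fun n _ => ?_)
  rw [← sub_mul, norm_mul, norm_pow]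
  gcongr
  exact (mem_closedBall_zero_iff.1 hz).trans (le_abs_self R)

/-- A power series with bounded coefficients is analytic in the unit disk. -/
theorem analyticOnNhd_tsum {a : ℕ → ℂ} {C : ℝ} (ha : ∀ n, ‖a n‖ ≤ C) :
    AnalyticOnNhd ℂ (fun z => ∑' n, a n * z ^ n) (Metric.ball 0 1) := by
  refine DifferentiableOn.analyticOnNhd (fun z hz => ?_) Metric.isOpen_ball
  obtain ⟨ρ, hzρ, hρ⟩ := exists_between (mem_ball_zero_iff.1 hz)
  have hρ₀ : 0 ≤ ρ := (norm_nonneg z).trans hzρ.le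
  have hd : DifferentiableOn ℂ (fun z => ∑' n, a n * z ^ n) (Metric.ball 0 ρ) := by
    refine Complex.differentiableOn_tsum_of_summable_norm
      (u := fun n => C * ρ ^ n) ((summable_geometric_of_lt_one hρ₀ hρ).mul_left C)
      (fun n => by fun_prop) Metric.isOpen_ball fun n w hw => ?_
    have hC : 0 ≤ C := (norm_nonneg _).trans (ha 0)
    rw [norm_mul, norm_pow]
    gcongr
    · exact ha n
    · exact (mem_ball_zero_iff.1 hw).le
  exact (hd.differentiableAt (Metric.isOpen_ball.mem_nhds
    (mem_ball_zero_iff.2 hzρ))).differentiableWithinAt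

theorem not_eventually_tsum_eq_zero {a : ℕ → ℂ} {C : ℝ} (ha : ∀ n, ‖a n‖ ≤ C) (h0 : a 0 ≠ 0)
    {z : ℂ} (hz : ‖z‖ < 1) : ¬ ∀ᶠ w in 𝓝 z, ∑' n, a n * w ^ n = 0 := by
  intro h
  have := (analyticOnNhd_tsum ha).eqOn_zero_of_preconnected_of_eventuallyEq_zero
    (convex_ball (0 : ℂ) 1).isPreconnected (mem_ball_zero_iff.2 hz) h
    (Metric.mem_ball_self one_pos)
  simp only [Pi.zero_apply] at this
  rw [tsum_eq_single 0 (fun n hn => by simp [hn])] at this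
  simp [h0] at this

/-- Points of `𝓖_{[0,1]}` are limits of zeros of the truncations of a series. -/
theorem eventually_exists_truncation_zero {a : ℕ → ℝ} (ha₀ : a 0 = 1)
    (ha : ∀ n, a n ∈ Set.Icc (0 : ℝ) 1) {z : ℂ} (hz : ‖z‖ < 1)
    (hsum : HasSum (fun n => (a n : ℂ) * z ^ n) 0) {ε : ℝ} (hε : 0 < ε) :
    ∀ᶠ N in atTop, ∃ w, dist w z < ε ∧ ∑ n ∈ Finset.range N, (a n : ℂ) * w ^ n = 0 := by
  have hb : ∀ n, ‖(a n : ℂ)‖ ≤ 1 := fun n => norm_ofReal_le_one_of_mem_Icc (ha n)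
  obtain ⟨ρ, hzρ, hρ⟩ := exists_between hz
  have hρ₀ : 0 ≤ ρ := (norm_nonneg z).trans hzρ.le
  refine eventually_exists_zero_of_tendstoUniformlyOn (r := ρ - ‖z‖)
    (f := fun w => ∑' n, (a n : ℂ) * w ^ n) (sub_pos.2 hzρ) (fun N => by fun_prop)
    (analyticOnNhd_tsum hb z (mem_ball_zero_iff.2 hz))
    (not_eventually_tsum_eq_zero hb (by simp [ha₀]) hz) hsum.tsum_eq ?_ hε
  refine tendstoUniformlyOn_tsum_nat (summable_geometric_of_lt_one hρ₀ hρ) fun n w hw => ?_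
  have hw' : ‖w‖ ≤ ρ := by
    have h1 := mem_ball_iff_norm.1 hw
    have h2 := norm_sub_norm_le w z
    linarith
  rw [norm_mul, norm_pow]
  calc ‖(a n : ℂ)‖ * ‖w‖ ^ n ≤ 1 * ρ ^ n := by gcongr; exact hb n
    _ = ρ ^ n := one_mul _

/-! ### The limit set is closed -/

/-- The set is the projection of a closed set of pairs (coefficients, zero) in a product that is
compact by Tychonoff; evaluation is continuous there, being dominated by a geometric series in `ρ`.
-/
theorem isCompact_zeroSet_inter_closedBall {ρ : ℝ} (hρ : ρ < 1) :
    IsCompact (zeroSet (Set.Icc (0 : ℝ) 1) ∩ Metric.closedBall 0 ρ) := by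
  let K : Set ((ℕ → ℝ) × ℂ) :=
    (Set.univ.pi fun _ => Set.Icc (0 : ℝ) 1) ×ˢ Metric.closedBall (0 : ℂ) ρ
  have hK : IsCompact K :=
    (isCompact_univ_pi fun _ => isCompact_Icc).prod (isCompact_closedBall _ _)
  let f : (ℕ → ℝ) × ℂ → ℂ := fun p => ∑' n, (p.1 n : ℂ) * p.2 ^ n
  have hf : ContinuousOn f K := by
    rcases lt_or_ge ρ 0 with h | h
    · have : K = ∅ := by simp [K, Metric.closedBall_eq_empty.2 h]
      simp [this]
    refine continuousOn_tsum (u := fun n => ρ ^ n) (fun n => by fun_prop)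
      (summable_geometric_of_lt_one h hρ) fun n p hp => ?_
    rw [norm_mul, norm_pow]
    calc ‖(p.1 n : ℂ)‖ * ‖p.2‖ ^ n ≤ 1 * ρ ^ n := by
          gcongr
          · exact norm_ofReal_le_one_of_mem_Icc (hp.1 n trivial)
          · exact mem_closedBall_zero_iff.1 hp.2
      _ = ρ ^ n := one_mul _
  let T : Set ((ℕ → ℝ) × ℂ) := (K ∩ f ⁻¹' {0}) ∩ {p | p.1 0 = 1}
  have hT : IsCompact T :=
    (hK.of_isClosed_subset (hf.preimage_isClosed_of_isClosed hK.isClosed isClosed_singleton)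
      Set.inter_subset_left).inter_right (isClosed_eq (by fun_prop) continuous_const)
  convert hT.image continuous_snd using 1
  ext z
  constructor
  · rintro ⟨hz, hzρ⟩
    obtain ⟨-, a, ha₀, ha, hs⟩ := mem_zeroSet_iff.1 hz
    exact ⟨(a, z), ⟨⟨⟨fun n _ => ha n, hzρ⟩, hs.tsum_eq⟩, ha₀⟩, rfl⟩
  · rintro ⟨⟨a, z⟩, ⟨⟨⟨ha, hzρ⟩, hs⟩, ha₀⟩, rfl⟩
    have hz : ‖z‖ < 1 := (mem_closedBall_zero_iff.1 hzρ).trans_lt hρ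
    refine ⟨mem_zeroSet_iff.2 ⟨hz, a, ha₀, fun n => ha n trivial, ?_⟩, hzρ⟩
    have := (summable_mul_pow (a := fun n => (a n : ℂ)) (C := 1)
      (fun n => norm_ofReal_le_one_of_mem_Icc (ha n trivial)) hz).of_norm.hasSum
    rwa [show ∑' n, (a n : ℂ) * z ^ n = 0 from hs] at this

/-- Only limits `w` outside the closed disk need care: near `w` the points `-u⁻¹` stay in a fixed
ball of radius below `1`, where the zero set is compact. -/
theorem isClosed_limitSet :
    IsClosed (closure (Metric.ball (0 : ℂ) 1) ∪ -(zeroSet (Set.Icc (0 : ℝ) 1))⁻¹) := by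
  refine isClosed_of_closure_subset fun w hw => ?_
  rcases le_or_gt ‖w‖ 1 with h | h
  · exact mem_limitSet_of_norm_le_one h
  obtain ⟨s, hs₁, hs⟩ := exists_between h
  have hw₀ : w ≠ 0 := norm_pos_iff.1 (by linarith)
  have hρ : s⁻¹ < 1 := inv_lt_one_of_one_lt₀ hs₁
  right
  rw [mem_neg_inv_zeroSet_iff]
  have hcl := (isCompact_zeroSet_inter_closedBall hρ).isClosed
  have htend : Tendsto (fun u : ℂ => -u⁻¹) (𝓝 w) (𝓝 (-w⁻¹)) := (tendsto_inv₀ hw₀).neg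
  refine (hcl.mem_of_frequently_of_tendsto ?_ htend).1
  have hfar : ∀ᶠ u in 𝓝 w, s < ‖u‖ := (continuous_norm.tendsto w).eventually (lt_mem_nhds hs)
  refine ((mem_closure_iff_frequently.1 hw).and_eventually hfar).mono ?_
  rintro u ⟨hu | hu, hsu⟩
  · rw [closure_ball _ one_ne_zero, mem_closedBall_zero_iff] at hu
    linarith
  · refine ⟨mem_neg_inv_zeroSet_iff.1 hu, ?_⟩
    rw [mem_closedBall_zero_iff, norm_neg, norm_inv]
    exact inv_anti₀ (by linarith) hsu.le

end GenBeta

namespace GenBeta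

open Filter Topology Polynomial

/-! ### Simple generalized Parry numbers with prescribed digits -/

/-- The alternating sum `d₀/β - d₁/β² + ⋯ ± d_{n-1}/βⁿ`. -/
noncomputable def altSum (β : ℝ) : (ℕ → ℕ) → ℕ → ℝ
  | _, 0 => 0
  | d, n + 1 => (d 0 - altSum β (fun i => d (i + 1)) n) / β

theorem altSum_succ (β : ℝ) (d : ℕ → ℕ) (n : ℕ) :
    altSum β d (n + 1) = (d 0 - altSum β (fun i => d (i + 1)) n) / β := rfl

theorem pow_mul_altSum {β : ℝ} (hβ : β ≠ 0) (d : ℕ → ℕ) (n : ℕ) :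
    β ^ n * altSum β d n = ∑ i ∈ Finset.range n, (-1) ^ i * d i * β ^ (n - 1 - i) := by
  induction n generalizing d with
  | zero => simp [altSum]
  | succ n ih =>
    have h : ∀ i, n + 1 - 1 - (i + 1) = n - 1 - i := fun i => by omega
    rw [altSum_succ, Finset.sum_range_succ']
    simp only [h, pow_succ _ (_ : ℕ)]
    have := ih fun i => d (i + 1)
    calc β ^ n * β * ((d 0 - altSum β (fun i => d (i + 1)) n) / β)
        = d 0 * β ^ n - β ^ n * altSum β (fun i => d (i + 1)) n := by field_simp
      _ = _ := by
        rw [this, sub_eq_neg_add, ← Finset.sum_neg_distrib]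
        simp

/-- With a tail in `[0,1)` the numerator `d 0 - tail` lies in `(1, D - 1]`, so dividing by `β ≥ D`
lands in `(0,1)`. The value `0` is needed only for the empty sum. -/
theorem altSum_mem_Ico {β : ℝ} {D : ℕ} (hβ : D ≤ β) {d : ℕ → ℕ} (hd : ∀ i, 2 ≤ d i ∧ d i < D)
    (n : ℕ) : altSum β d n ∈ Set.Ico (0 : ℝ) 1 ∧ 0 < altSum β d (n + 1) := by
  have hD : (0 : ℝ) < D := by
    have := hd 0
    exact_mod_cast (show 0 < D by omega)
  have hβ₀ : 0 < β := hD.trans_le hβ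
  have hstep : ∀ {d : ℕ → ℕ}, (∀ i, 2 ≤ d i ∧ d i < D) → ∀ n,
      altSum β (fun i => d (i + 1)) n ∈ Set.Ico (0 : ℝ) 1 →
      0 < altSum β d (n + 1) ∧ altSum β d (n + 1) < 1 := by
    intro d hd n ⟨h₀, h₁⟩
    have h2 : (2 : ℝ) ≤ d 0 := by exact_mod_cast (hd 0).1
    have h3 : (d 0 : ℝ) < D := by exact_mod_cast (hd 0).2
    rw [altSum_succ]
    constructor
    · exact div_pos (by linarith) hβ₀
    · rw [div_lt_one hβ₀]; linarith
  have hmem : ∀ n, ∀ {d : ℕ → ℕ}, (∀ i, 2 ≤ d i ∧ d i < D) →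
      altSum β d n ∈ Set.Ico (0 : ℝ) 1 := by
    intro n
    induction n with
    | zero => intro d _; simp [altSum]
    | succ n ih =>
      intro d hd
      have := hstep hd n (ih fun i => hd (i + 1))
      exact ⟨this.1.le, this.2⟩
  exact ⟨hmem n hd, (hstep hd n (hmem n fun i => hd (i + 1))).1⟩

theorem continuousOn_altSum (d : ℕ → ℕ) (n : ℕ) :
    ContinuousOn (fun β => altSum β d n) (Set.Ioi 0) := by
  induction n generalizing d with
  | zero => simp only [altSum]; exact continuousOn_const
  | succ n ih =>
    simp only [altSum_succ]
    exact (continuousOn_const.sub (ih _)).div continuousOn_id fun x hx => (Set.mem_Ioi.1 hx).ne'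

theorem tau_E₁_of_eq_div {β x : ℝ} (hβ : β ≠ 0) (h₀ : 0 < x) (h₁ : x ≤ 1) (d : ℕ) :
    tau β E₁ ((d - x) / β) = x := by
  have : Int.fract (β * ((d - x) / β)) = 1 - x := by
    rw [Int.fract_eq_iff, mul_div_cancel₀ _ hβ]
    exact ⟨by linarith, by linarith, d - 1, by push_cast; ring⟩
  rw [tau_E₁, this]
  ring

/-- The map acts on alternating expansions as the shift, dropping the first digit, until a single
digit over `β` remains. -/
theorem exists_iterate_altSum_mem_endPts {β : ℝ} {D : ℕ} (hβ : D ≤ β) (n : ℕ) {d : ℕ → ℕ}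
    (hd : ∀ i, 2 ≤ d i ∧ d i < D) : ∃ k, (tau β E₁)^[k] (altSum β d (n + 1)) ∈ endPts β := by
  have hβ₀ : 0 < β := by
    have := hd 0
    exact lt_of_lt_of_le (by exact_mod_cast (show 0 < D by omega)) hβ
  induction n generalizing d with
  | zero =>
    refine ⟨0, d 0, by linarith [(hd 0).1], Nat.le_floor ?_, by simp [altSum]⟩
    exact le_trans (by exact_mod_cast (hd 0).2.le) hβ
  | succ n ih =>
    obtain ⟨k, hk⟩ := ih fun i => hd (i + 1)
    refine ⟨k + 1, ?_⟩
    have h₀ := (altSum_mem_Ico hβ (fun i => hd (i + 1)) n).2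
    have h₁ := (altSum_mem_Ico hβ (fun i => hd (i + 1)) (n + 1)).1.2
    rwa [Function.iterate_succ_apply, altSum_succ, tau_E₁_of_eq_div hβ₀.ne' h₀ h₁.le]

/-- The monic polynomial `X^N - d₀ X^{N-1} + d₁ X^{N-2} - ⋯`. -/
noncomputable def digitPoly (d : ℕ → ℕ) (N : ℕ) : ℤ[X] :=
  X ^ N - ∑ i ∈ Finset.range N, C ((-1) ^ i * (d i : ℤ)) * X ^ (N - 1 - i)

theorem aeval_digitPoly {A : Type*} [CommRing A] (d : ℕ → ℕ) (N : ℕ) (x : A) :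
    aeval x (digitPoly d N) =
      x ^ N - ∑ i ∈ Finset.range N, (-1) ^ i * (d i : A) * x ^ (N - 1 - i) := by
  simp [digitPoly]

/-- A leading digit that exceeds all other digits by at least two makes a digit sequence the
expansion of a simple generalized Parry number. -/
theorem exists_isSimple_of_digits {D : ℕ} {d : ℕ → ℕ} (hd₀ : d 0 = D + 1)
    (hd : ∀ i, 2 ≤ d (i + 1) ∧ d (i + 1) < D) (n : ℕ) :
    ∃ β : ℝ, D < β ∧ β < D + 1 ∧ IsSimple β E₁ ∧ aeval β (digitPoly d (n + 2)) = 0 := by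
  have hD : (0 : ℝ) < D := by
    have := hd 0
    exact_mod_cast (show 0 < D by omega)
  let T : ℝ → ℝ := fun β => altSum β (fun i => d (i + 1)) (n + 1)
  have hT : ∀ β : ℝ, D ≤ β → T β ∈ Set.Ioo (0 : ℝ) 1 := fun β hβ =>
    ⟨(altSum_mem_Ico hβ hd n).2, (altSum_mem_Ico hβ hd (n + 1)).1.2⟩
  -- The equation `d 0 - T β = β` says that the full alternating sum is `1`. The difference is `1 -
  -- T D > 0` at `D` and `-T (D + 1) < 0` at `D + 1`.
  have hcont : ContinuousOn (fun β => d 0 - T β - β) (Set.Icc (D : ℝ) (D + 1)) :=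
    (continuousOn_const.sub ((continuousOn_altSum _ _).mono fun x hx =>
      hD.trans_le hx.1)).sub continuousOn_id
  have h1 := hT D le_rfl
  have h2 := hT (D + 1) (by linarith)
  have hd₀' : (d 0 : ℝ) = D + 1 := by exact_mod_cast hd₀
  obtain ⟨β, ⟨hβ₁, -⟩, hβ⟩ := intermediate_value_Icc' (by linarith) hcont
    (show (0 : ℝ) ∈ _ from ⟨by linarith [h2.1], by linarith [h1.2]⟩)
  have h3 := hT β hβ₁
  have hβeq : d 0 - T β = β := by simpa [sub_eq_zero] using hβ
  have hβ₀ : 0 < β := hD.trans_le hβ₁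
  have hone : altSum β d (n + 2) = 1 := by
    rw [altSum_succ]
    exact (div_eq_one_iff_eq hβ₀.ne').2 hβeq
  refine ⟨β, by linarith [h3.2], by linarith [h3.1], ?_, ?_⟩
  · obtain ⟨k, hk⟩ := exists_iterate_altSum_mem_endPts hβ₁ n hd
    refine ⟨k + 1, Nat.le_add_left 1 k, ?_⟩
    rw [orbitPt, ← hone, Function.iterate_succ_apply, altSum_succ,
      tau_E₁_of_eq_div hβ₀.ne' h3.1 h3.2.le]
    exact hk
  · rw [aeval_digitPoly, ← pow_mul_altSum hβ₀.ne', hone, mul_one, sub_self]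

theorem degree_sum_C_mul_X_pow_lt (a : ℕ → ℤ) (N : ℕ) :
    (∑ i ∈ Finset.range N, C (a i) * X ^ (N - 1 - i) : ℤ[X]).degree < (N : WithBot ℕ) := by
  refine mem_degreeLT.1 (Submodule.sum_mem _ fun i hi => mem_degreeLT.2 ?_)
  refine (degree_C_mul_X_pow_le _ _).trans_lt ?_
  have := Finset.mem_range.1 hi
  exact_mod_cast (show N - 1 - i < N by omega)

theorem monic_digitPoly (d : ℕ → ℕ) (N : ℕ) : (digitPoly d N).Monic :=
  monic_X_pow_sub (degree_sum_C_mul_X_pow_lt _ N)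

theorem degree_digitPoly (d : ℕ → ℕ) (N : ℕ) : (digitPoly d N).degree = N := by
  rw [digitPoly, degree_sub_eq_left_of_degree_lt, degree_X_pow]
  rw [degree_X_pow]
  exact degree_sum_C_mul_X_pow_lt _ N

/-- Eisenstein's criterion at `2`. -/
theorem irreducible_digitPoly {d : ℕ → ℕ} {n : ℕ} (hd : ∀ i, 2 ∣ d i) (hn : ¬ 4 ∣ d n) :
    Irreducible (digitPoly d (n + 1)) := by
  have hmon := monic_digitPoly d (n + 1)
  have hdeg := degree_digitPoly d (n + 1)
  refine irreducible_of_eisenstein_criterion (P := Ideal.span {2})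
    ((Ideal.span_singleton_prime two_ne_zero).2 Int.prime_two) ?_ ?_ ?_ ?_ hmon.isPrimitive
  · rw [hmon.leadingCoeff, Ideal.mem_span_singleton]
    decide
  · intro k hk
    rw [hdeg, Nat.cast_lt] at hk
    rw [Ideal.mem_span_singleton, digitPoly, coeff_sub, coeff_X_pow, if_neg hk.ne, zero_sub,
      dvd_neg, finsetSum_coeff]
    refine Finset.dvd_sum fun i _ => ?_
    rw [coeff_C_mul]
    exact ((Int.natCast_dvd_natCast.2 (hd i)).mul_left _).mul_right _
  · rw [hdeg]
    exact_mod_cast n.succ_pos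
  · rw [Ideal.span_singleton_pow, Ideal.mem_span_singleton, coeff_zero_eq_eval_zero,
      ← coe_aeval_eq_eval, aeval_digitPoly, Finset.sum_range_succ, Finset.sum_eq_zero]
    · simp only [ne_eq, Nat.add_eq_zero_iff, one_ne_zero, and_false, not_false_eq_true, zero_pow,
        zero_add, zero_sub, dvd_neg, Nat.add_sub_cancel, Nat.sub_self, pow_zero, mul_one]
      intro h
      rw [(isUnit_one.neg.pow n).dvd_mul_left] at h
      exact hn (by exact_mod_cast h)
    · intro i hi
      have := Finset.mem_range.1 hi
      rw [zero_pow (by omega), mul_zero]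

/-- The reciprocal form of `digitPoly`. -/
theorem neg_pow_mul_aeval_digitPoly (d : ℕ → ℕ) (N : ℕ) {w : ℂ} (hw : w ≠ 0) :
    (-w) ^ N * aeval (-w⁻¹) (digitPoly d N) =
      1 + ∑ i ∈ Finset.range N, (d i : ℂ) * w ^ (i + 1) := by
  have hww : -w * -w⁻¹ = 1 := by field_simp
  rw [aeval_digitPoly, mul_sub, ← mul_pow, hww, one_pow, sub_eq_add_neg, Finset.mul_sum,
    ← Finset.sum_neg_distrib]
  congr 1
  refine Finset.sum_congr rfl fun i hi => ?_
  obtain ⟨j, rfl⟩ : ∃ j, N = j + (i + 1) := ⟨N - (i + 1), by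
    have := Finset.mem_range.1 hi
    omega⟩
  have h1 : j + (i + 1) - 1 - i = j := by omega
  rw [h1, pow_add (-w)]
  have h2 : (-w) ^ j * (-w⁻¹) ^ j = 1 := by rw [← mul_pow, hww, one_pow]
  have h3 : (-w) ^ (i + 1) * (-1) ^ i = -w ^ (i + 1) := by
    rw [neg_pow w, pow_succ (-1 : ℂ) i]
    have : ((-1 : ℂ) ^ i) * (-1) ^ i = 1 := by rw [← mul_pow]; simp
    linear_combination (-w ^ (i + 1)) * this
  linear_combination (-(d i : ℂ) * (-w) ^ (i + 1) * (-1) ^ i) * h2 - (d i : ℂ) * h3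

/-- Zeros of integer polynomials with suitable digits as coefficients give Galois conjugates of
simple generalized Parry numbers. -/
theorem exists_galoisConjugate_of_digits {D : ℕ} {d : ℕ → ℕ} (hd₀ : d 0 = D + 1)
    (hd : ∀ i, 2 ≤ d (i + 1) ∧ d (i + 1) < D) (heven : ∀ i, 2 ∣ d i) (n : ℕ)
    (hn : ¬ 4 ∣ d (n + 1)) {w : ℂ} (hw : w ≠ 0) (hwD : ‖w⁻¹‖ ≤ D)
    (hzero : 1 + ∑ i ∈ Finset.range (n + 2), (d i : ℂ) * w ^ (i + 1) = 0) :
    ∃ β : ℝ, IsSimpleGenParry β E₁ ∧ -w⁻¹ ∈ galoisConjugates β := by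
  obtain ⟨β, hβ₁, hβ₂, hs, hroot⟩ := exists_isSimple_of_digits hd₀ hd n
  have hD : (2 : ℝ) < D := by
    have := hd 0
    exact_mod_cast (show 2 < D by omega)
  have hmon := monic_digitPoly d (n + 2)
  have hirr := (hmon.irreducible_iff_irreducible_map_fraction_map (K := ℚ)).1
    (irreducible_digitPoly heven hn)
  have hmin : (digitPoly d (n + 2)).map (algebraMap ℤ ℚ) = minpoly ℚ β :=
    minpoly.eq_of_irreducible_of_monic hirr (by rwa [aeval_map_algebraMap]) (hmon.map _)
  refine ⟨β, ⟨⟨⟨by linarith, fun k hk => ?_⟩,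
    finite_range_orbitPt_of_isSimple (by linarith) hs⟩, hs⟩, ?_, fun h => ?_⟩
  · rw [hk] at hβ₁ hβ₂
    have h1 : (D : ℤ) < k := by exact_mod_cast hβ₁
    have h2 : k < (D : ℤ) + 1 := by exact_mod_cast hβ₂
    omega
  · rw [← hmin, mem_rootSet, aeval_map_algebraMap]
    refine ⟨(hmon.map _).ne_zero, ?_⟩
    rw [← neg_pow_mul_aeval_digitPoly d _ hw] at hzero
    exact (mul_eq_zero.1 hzero).resolve_left (pow_ne_zero _ (neg_ne_zero.2 hw))
  -- The bound `‖w⁻¹‖ ≤ D < β` separates this root from `β`.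
  · have := congrArg norm h
    rw [norm_neg, Complex.norm_real, Real.norm_of_nonneg (by linarith)] at this
    linarith

/-! ### Zeros of polynomials with coefficients in the unit interval -/

theorem tendsto_natFloor_mul_div {c : ℝ} (hc : 0 ≤ c) :
    Tendsto (fun t : ℕ => ((2 + 4 * ⌊c * t⌋₊ : ℕ) : ℂ) / (4 * t)) atTop (𝓝 (c : ℂ)) := by
  have h1 : Tendsto (fun t : ℕ => (⌊c * t⌋₊ : ℝ) / t) atTop (𝓝 c) :=
    (tendsto_nat_floor_mul_div_atTop hc).comp tendsto_natCast_atTop_atTop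
  have h2 : Tendsto (fun t : ℕ => (2 / 4 : ℝ) / t) atTop (𝓝 0) :=
    tendsto_const_div_atTop_nhds_zero_nat _
  have h3 := h2.add h1
  rw [zero_add] at h3
  have h4 := (Complex.continuous_ofReal.tendsto c).comp h3
  refine h4.congr' ?_
  filter_upwards [eventually_gt_atTop 0] with t ht
  have : (t : ℂ) ≠ 0 := by exact_mod_cast ht.ne'
  simp only [Function.comp_apply]
  push_cast
  field_simp

/-- Divided by `4 t`, the reciprocal digit polynomials converge to `w * ∑ c i w^i`, since their
constant term `1` is scaled away. Hurwitz's theorem then moves the zero `w₀` to zeros that give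
conjugates. -/
theorem neg_inv_mem_Phi_of_polynomial_zero {c : ℕ → ℝ} (hc₀ : c 0 = 1)
    (hc : ∀ i, c i ∈ Set.Icc (0 : ℝ) 1) (n : ℕ) {w₀ : ℂ}
    (hw₀ : ∑ i ∈ Finset.range (n + 2), (c i : ℂ) * w₀ ^ i = 0) : -w₀⁻¹ ∈ Phi E₁ := by
  have hw₀' : w₀ ≠ 0 := by
    rintro rfl
    rw [Finset.sum_range_succ'] at hw₀
    simp [hc₀] at hw₀
  -- All digits are even and those after the first are `2` mod `4`, as Eisenstein requires. They are
  -- at most `4 t + 2`, below `D = 4 t + 3`, while the first is `D + 1`.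
  let d : ℕ → ℕ → ℕ := fun t i => if i = 0 then 4 * t + 4 else 2 + 4 * ⌊c i * t⌋₊
  let p : ℕ → ℕ → ℂ := fun t j => Nat.casesOn j (1 / (4 * t)) fun i => (d t i : ℂ) / (4 * t)
  let q : ℕ → ℂ := fun j => Nat.casesOn j 0 fun i => (c i : ℂ)
  have hp : ∀ t w, ∑ j ∈ Finset.range (n + 3), p t j * w ^ j =
      (1 / (4 * t)) * (1 + ∑ i ∈ Finset.range (n + 2), (d t i : ℂ) * w ^ (i + 1)) := by
    intro t w
    rw [Finset.sum_range_succ', add_comm 1, mul_add, Finset.mul_sum]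
    congr 1
    · refine Finset.sum_congr rfl fun i _ => ?_
      simp only [p]
      ring
  have hq : ∀ w, ∑ j ∈ Finset.range (n + 3), q j * w ^ j =
      w * ∑ i ∈ Finset.range (n + 2), (c i : ℂ) * w ^ i := by
    intro w
    rw [Finset.sum_range_succ', Finset.mul_sum]
    have hq₀ : q 0 * w ^ 0 = 0 := by simp [q]
    rw [hq₀, add_zero]
    refine Finset.sum_congr rfl fun i _ => ?_
    simp only [q]
    ring
  have hlim : ∀ j < n + 3, Tendsto (fun t => p t j) atTop (𝓝 (q j)) := by
    intro j _
    have hinv : Tendsto (fun t : ℕ => (1 : ℂ) / (4 * t)) atTop (𝓝 0) := by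
      have := (tendsto_inv_atTop_nhds_zero_nat (𝕜 := ℂ)).const_mul (1 / 4)
      rw [mul_zero] at this
      refine this.congr fun t => ?_
      rw [one_div, one_div, mul_inv]
    rcases j with _ | _ | i
    · exact hinv
    · have h1 := (hinv.const_mul 2).add (tendsto_natFloor_mul_div zero_le_one)
      simp only [p, q, d, hc₀]
      rw [mul_zero, zero_add] at h1
      refine h1.congr fun t => ?_
      simp only [one_mul, Nat.floor_natCast, if_true]
      push_cast
      ring
    · simpa [p, q, d] using tendsto_natFloor_mul_div (hc (i + 1)).1
  have hne : ¬ ∀ᶠ w in 𝓝 w₀, ∑ j ∈ Finset.range (n + 3), q j * w ^ j = 0 := by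
    intro h
    have han : AnalyticOnNhd ℂ (fun w : ℂ => ∑ i ∈ Finset.range (n + 2), (c i : ℂ) * w ^ i)
        Set.univ :=
      DifferentiableOn.analyticOnNhd (by fun_prop) isOpen_univ
    have h1 : ∀ᶠ w in 𝓝 w₀, ∑ i ∈ Finset.range (n + 2), (c i : ℂ) * w ^ i = 0 := by
      filter_upwards [h, isOpen_ne.mem_nhds hw₀'] with w hw hw'
      rw [hq] at hw
      exact (mul_eq_zero.1 hw).resolve_left hw'
    have h2 := han.eqOn_zero_of_preconnected_of_eventuallyEq_zero isPreconnected_univ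
      (Set.mem_univ w₀) h1 (Set.mem_univ 0)
    simp only [Pi.zero_apply] at h2
    rw [Finset.sum_range_succ'] at h2
    simp [hc₀] at h2
  refine mem_closure_iff_nhds.2 fun U hU => ?_
  have hinv : Tendsto (fun u : ℂ => u⁻¹) (𝓝 w₀) (𝓝 w₀⁻¹) := tendsto_inv₀ hw₀'
  have hnear : ∀ᶠ w in 𝓝 w₀, -w⁻¹ ∈ U ∧ w ≠ 0 ∧ ‖w⁻¹‖ < ‖w₀⁻¹‖ + 1 :=
    (hinv.neg.eventually hU).and ((eventually_ne_nhds hw₀').and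
      (hinv.norm.eventually (gt_mem_nhds (lt_add_one ‖w₀⁻¹‖))))
  obtain ⟨ε, hε, hball⟩ := Metric.eventually_nhds_iff.1 hnear
  have hz := eventually_exists_zero_of_tendstoUniformlyOn (z₀ := w₀) (r := 1) one_pos
    (fun t => by fun_prop)
    (Differentiable.analyticAt (f := fun w => ∑ j ∈ Finset.range (n + 3), q j * w ^ j)
      (by fun_prop) w₀)
    hne (by rw [hq, hw₀, mul_zero])
    ((tendstoUniformlyOn_sum_mul_pow (n + 3) hlim (‖w₀‖ + 1)).mono fun w hw => by
      have h1 := mem_ball_iff_norm.1 hw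
      have h2 := norm_sub_norm_le w w₀
      exact mem_closedBall_zero_iff.2 (by linarith)) hε
  obtain ⟨t, ⟨w, hwε, hwz⟩, ht₁, ht⟩ := (hz.and ((eventually_gt_atTop 0).and
    (eventually_ge_atTop ⌈‖w₀⁻¹‖ + 1⌉₊))).exists
  obtain ⟨hwU, hw, hwn⟩ := hball hwε
  rw [hp] at hwz
  have ht₀ : (1 : ℂ) / (4 * t) ≠ 0 := by
    have : (t : ℂ) ≠ 0 := by exact_mod_cast ht₁.ne'
    simp [this]
  have hwz' := (mul_eq_zero.1 hwz).resolve_left ht₀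
  refine ⟨-w⁻¹, hwU, exists_galoisConjugate_of_digits (D := 4 * t + 3) (d := d t) (by simp [d])
    (fun i => ?_) (fun i => ?_) n ?_ hw ?_ hwz'⟩
  · simp only [d, Nat.succ_ne_zero, if_false]
    have : ⌊c (i + 1) * t⌋₊ ≤ t := by
      refine Nat.floor_le_of_le ?_
      exact mul_le_of_le_one_left (Nat.cast_nonneg t) (hc (i + 1)).2
    omega
  · simp only [d]
    split_ifs <;> omega
  · simp only [d, Nat.succ_ne_zero, if_false]
    omega
  · have h1 := Nat.ceil_le.1 ht
    push_cast
    linarith [(Nat.cast_nonneg t : (0 : ℝ) ≤ t)]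

end GenBeta

namespace GenBeta

open Filter Topology

/-! ### The limit set is contained in `Φ` -/

theorem neg_inv_zeroSet_subset_Phi : -(zeroSet (Set.Icc (0 : ℝ) 1))⁻¹ ⊆ Phi E₁ := by
  intro u hu
  obtain ⟨hz, a, ha₀, ha, hs⟩ := mem_zeroSet_iff.1 (mem_neg_inv_zeroSet_iff.1 hu)
  set z := -u⁻¹ with hzdef
  have hz₀ : z ≠ 0 := by
    intro h
    rw [h] at hs
    have := hs.unique (hasSum_single 0 fun n hn => by simp [hn])
    simp [ha₀] at this
  have hu' : u = -z⁻¹ := by rw [hzdef]; simp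
  have hclosed : IsClosed (Phi E₁) := isClosed_closure
  rw [hu', ← hclosed.closure_eq]
  refine mem_closure_iff_nhds.2 fun U hU => ?_
  obtain ⟨ε, hε, hball⟩ := Metric.eventually_nhds_iff.1 ((tendsto_inv₀ hz₀).neg.eventually hU)
  obtain ⟨N, ⟨w, hwε, hw⟩, hN⟩ :=
    ((eventually_exists_truncation_zero ha₀ ha hz hs hε).and (eventually_ge_atTop 2)).exists
  obtain ⟨n, rfl⟩ := Nat.exists_eq_add_of_le' hN
  exact ⟨-w⁻¹, hball hwε, neg_inv_mem_Phi_of_polynomial_zero ha₀ ha n hw⟩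

/-- If `v` is a non-real point of the unit disk whose argument is a rational multiple of `π`, then
`v` is a zero of a monic polynomial with coefficients in `[0,1]`. -/
theorem exists_monic_unitInterval_relation {v ζ : ℂ} {r : ℝ} (hr₀ : 0 < r) (hr : r < 1)
    (hv : v = r * ζ) (him : v.im ≠ 0) {m : ℕ} (hζm : ζ ^ m = 1) (hm : m ≠ 0) :
    ∃ (N : ℕ) (e : ℕ → ℝ), 1 ≤ N ∧ e N = 1 ∧ (∀ j, e j ∈ Set.Icc (0 : ℝ) 1) ∧
      ∑ j ∈ Finset.range (N + 1), (e j : ℂ) * v ^ j = 0 := by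
  have hζ₁ : ζ ≠ 1 := by
    rintro rfl
    simp [hv] at him
  have hm₂ : 2 ≤ m := by
    rcases m with _ | _ | m
    · exact absurd rfl hm
    · exact absurd (by simpa using hζm) hζ₁
    · omega
  have hvn : ‖v‖ < 1 := by
    have : ‖ζ‖ = 1 := Complex.norm_eq_one_of_pow_eq_one hζm hm
    rw [hv, norm_mul, this, mul_one, Complex.norm_real, Real.norm_of_nonneg hr₀.le]
    exact hr
  have hpow : Tendsto (fun N : ℕ => v ^ N) atTop (𝓝 0) :=
    tendsto_pow_atTop_nhds_zero_of_norm_lt_one hvn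
  -- As `v` is not real, `1` and `v` span `ℂ` over `ℝ`; `A N` and `B N` are the coordinates of
  -- `-v^N`, which tend to `0`.
  let B : ℕ → ℝ := fun N => -(v ^ N).im / v.im
  let A : ℕ → ℝ := fun N => -(v ^ N).re - B N * v.re
  have hBlim : Tendsto B atTop (𝓝 0) := by
    have := (((Complex.continuous_im.tendsto 0).comp hpow).neg).div_const v.im
    simpa using this
  have hAlim : Tendsto A atTop (𝓝 0) := by
    have := (((Complex.continuous_re.tendsto 0).comp hpow).neg).sub (hBlim.mul_const v.re)
    simpa using this
  have hAB : ∀ N, (A N : ℂ) + B N * v = -v ^ N := by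
    intro N
    apply Complex.ext
    · simp [A]
    · simp [B, him]
  set δ := r ^ m / 2 with hδ
  have hδ₀ : 0 < δ := by positivity
  obtain ⟨N, hA, hB, hN⟩ := ((hAlim.abs.eventually (gt_mem_nhds (by simpa using hδ₀))).and
    ((hBlim.abs.eventually (gt_mem_nhds (by simpa using hδ₀))).and
      (eventually_gt_atTop m))).exists
  -- These weights cancel the moduli of `v^j`, leaving a multiple of the vanishing sum `∑ ζ^j`. As
  -- `t 0` and `t 1` lie in `[δ, 1/2]`, adding `A N` and `B N` keeps the coefficients in `[0,1]`.
  let t : ℕ → ℝ := fun j => if j < m then r ^ (m - 1 - j) / 2 else 0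
  let e : ℕ → ℝ := fun j => if j = N then 1 else
    t j + ((if j = 0 then A N else 0) + if j = 1 then B N else 0)
  have hδle : δ ≤ 1 / 2 := by
    have := pow_le_one₀ (n := m) hr₀.le hr.le
    rw [hδ]; linarith
  have ht : ∀ j, t j ∈ Set.Icc (0 : ℝ) (1 / 2) ∧ (j < m → δ ≤ t j) := by
    intro j
    have h1 := pow_le_one₀ (n := m - 1 - j) hr₀.le hr.le
    have h2 := pow_pos hr₀ (m - 1 - j)
    have h3 : r ^ m ≤ r ^ (m - 1 - j) := pow_le_pow_of_le_one hr₀.le hr.le (by omega)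
    simp only [t]
    split_ifs with h
    · exact ⟨⟨by linarith, by linarith⟩, fun _ => by rw [hδ]; linarith⟩
    · exact ⟨⟨le_rfl, by norm_num⟩, fun h' => absurd h' h⟩
  refine ⟨N, e, by omega, by simp [e], fun j => ?_, ?_⟩
  · obtain ⟨⟨h1, h2⟩, h3⟩ := ht j
    rw [abs_lt] at hA hB
    simp only [e]
    split_ifs with hj h0 h1' h1'
    · simp
    · omega
    · have := h3 (by omega)
      constructor <;> linarith
    · have := h3 (by omega)
      constructor <;> linarith
    · constructor <;> linarith
  · have htsum : ∑ j ∈ Finset.range N, (t j : ℂ) * v ^ j = 0 := by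
      have hsub : Finset.range m ⊆ Finset.range N := Finset.range_mono hN.le
      rw [← Finset.sum_subset hsub]
      · have : ∀ j ∈ Finset.range m, (t j : ℂ) * v ^ j = (r : ℂ) ^ (m - 1) / 2 * ζ ^ j := by
          intro j hj
          have hj' := Finset.mem_range.1 hj
          simp only [t, if_pos hj']
          rw [hv, mul_pow]
          push_cast
          have : (r : ℂ) ^ (m - 1) = (r : ℂ) ^ (m - 1 - j) * (r : ℂ) ^ j := by
            rw [← pow_add]; congr 1; omega
          rw [this]
          ring
        rw [Finset.sum_congr rfl this, ← Finset.mul_sum]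
        have hg := geom_sum_mul ζ m
        rw [hζm, sub_self] at hg
        rw [(mul_eq_zero.1 hg).resolve_right (sub_ne_zero.2 hζ₁), mul_zero]
      · intro j _ hj
        have hj' : ¬ j < m := by simpa using hj
        simp [t, hj']
    have hAsum : ∑ j ∈ Finset.range N, (((if j = 0 then A N else 0 : ℝ) : ℂ)) * v ^ j = A N := by
      rw [Finset.sum_eq_single_of_mem 0 (by simp; omega) fun j _ hj => by simp [hj]]
      simp
    have hBsum : ∑ j ∈ Finset.range N, (((if j = 1 then B N else 0 : ℝ) : ℂ)) * v ^ j =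
        B N * v := by
      rw [Finset.sum_eq_single_of_mem 1 (by simp; omega) fun j _ hj => by simp [hj]]
      simp
    have hsum : ∑ j ∈ Finset.range N, (e j : ℂ) * v ^ j = A N + B N * v := by
      rw [← hAsum, ← hBsum, ← zero_add (_ + _), ← htsum, ← Finset.sum_add_distrib,
        ← Finset.sum_add_distrib]
      refine Finset.sum_congr rfl fun j hj => ?_
      simp only [e, if_neg (Finset.mem_range.1 hj).ne]
      push_cast
      ring
    rw [Finset.sum_range_succ, hsum, hAB]
    simp [e]

theorem neg_mem_Phi_of_rational_angle {v ζ : ℂ} {r : ℝ} (hr₀ : 0 < r) (hr : r < 1)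
    (hv : v = r * ζ) (him : v.im ≠ 0) {m : ℕ} (hζm : ζ ^ m = 1) (hm : m ≠ 0) : -v ∈ Phi E₁ := by
  obtain ⟨N, e, hN, heN, he, hsum⟩ := exists_monic_unitInterval_relation hr₀ hr hv him hζm hm
  have hv₀ : v ≠ 0 := by rintro rfl; simp at him
  obtain ⟨n, rfl⟩ := Nat.exists_eq_add_of_le' hN
  -- Reversing the coefficients turns the monic relation for `v` into one for `v⁻¹` with constant
  -- term `1`.
  have h := neg_inv_mem_Phi_of_polynomial_zero (c := fun i => e (n + 1 - i)) (by simpa using heN)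
    (fun i => he _) n (w₀ := v⁻¹) ?_
  · rwa [inv_inv] at h
  · have hreflect := Finset.sum_range_reflect (fun j => (e j : ℂ) * v ^ j) (n + 1 + 1)
    rw [hsum] at hreflect
    have hmul : v ^ (n + 1) * ∑ i ∈ Finset.range (n + 2), (e (n + 1 - i) : ℂ) * v⁻¹ ^ i = 0 := by
      rw [← hreflect, Finset.mul_sum]
      refine Finset.sum_congr rfl fun i hi => ?_
      have hi' : i ≤ n + 1 := by
        have := Finset.mem_range.1 hi
        omega
      have h1 : n + 1 + 1 - 1 - i = n + 1 - i := by omega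
      have h2 : v ^ (n + 1) = v ^ (n + 1 - i) * v ^ i := by rw [← pow_add, Nat.sub_add_cancel hi']
      have h3 : v ^ i * v⁻¹ ^ i = 1 := by rw [← mul_pow, mul_inv_cancel₀ hv₀, one_pow]
      rw [h1, h2]
      linear_combination (e (n + 1 - i) : ℂ) * v ^ (n + 1 - i) * h3
    exact (mul_eq_zero.1 hmul).resolve_left (pow_ne_zero _ hv₀)

/-- Nonreal points with rational angle are dense in the disk, and `Phi E₁` is closed. -/
theorem ball_subset_Phi : Metric.ball (0 : ℂ) 1 ⊆ Phi E₁ := by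
  have hclosed : IsClosed (Phi E₁) := isClosed_closure
  have hnonreal : ∀ v : ℂ, ‖v‖ < 1 → v.im ≠ 0 → -v ∈ Phi E₁ := by
    intro v hv him
    have hv₀ : 0 < ‖v‖ := norm_pos_iff.2 (by rintro rfl; simp at him)
    let f : ℝ → ℂ := fun θ => ‖v‖ * Complex.exp (2 * Real.pi * Complex.I * θ)
    have hf : Continuous f := by fun_prop
    have hf₀ : f (v.arg / (2 * Real.pi)) = v := by
      have hpi : (Real.pi : ℂ) ≠ 0 := by exact_mod_cast Real.pi_ne_zero
      simp only [f]
      conv_rhs => rw [← Complex.norm_mul_exp_arg_mul_I v]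
      congr 2
      push_cast
      field_simp
    rw [← hclosed.closure_eq]
    refine mem_closure_iff.2 fun U hU hvU => ?_
    have hopen : IsOpen (f ⁻¹' {u | -u ∈ U ∧ u.im ≠ 0}) :=
      ((hU.preimage continuous_neg).inter
        (isOpen_ne.preimage Complex.continuous_im)).preimage hf
    obtain ⟨q, hqU, hqim⟩ := Rat.denseRange_cast.exists_mem_open hopen
      ⟨v.arg / (2 * Real.pi), by rw [Set.mem_preimage, hf₀]; exact ⟨hvU, him⟩⟩
    refine ⟨-f q, hqU, neg_mem_Phi_of_rational_angle hv₀ hv rfl hqim (m := q.den) ?_ q.den_nz⟩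
    rw [← Complex.exp_nat_mul, Complex.exp_eq_one_iff]
    refine ⟨q.num, ?_⟩
    have hq : (q.den : ℂ) * ((q : ℝ) : ℂ) = q.num := by
      have := Rat.den_mul_eq_num q
      exact_mod_cast congrArg (fun x : ℚ => (x : ℂ)) this
    linear_combination (2 * Real.pi * Complex.I) * hq
  intro v hv
  rw [← hclosed.closure_eq]
  refine mem_closure_iff.2 fun U hU hvU => ?_
  have hlim : Tendsto (fun t : ℝ => v + t * Complex.I) (𝓝 0) (𝓝 v) := by
    have : Continuous fun t : ℝ => v + t * Complex.I := by fun_prop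
    simpa using this.tendsto 0
  have hev : ∀ᶠ t : ℝ in 𝓝 0, v + t * Complex.I ∈ U ∩ Metric.ball 0 1 :=
    hlim.eventually ((hU.inter Metric.isOpen_ball).mem_nhds ⟨hvU, hv⟩)
  have hne : ∀ᶠ t : ℝ in 𝓝[≠] 0, v.im + t ≠ 0 := by
    rcases eq_or_ne v.im 0 with h | h
    · filter_upwards [self_mem_nhdsWithin] with t ht
      simpa [h] using ht
    · refine nhdsWithin_le_nhds ?_
      have : Tendsto (fun t : ℝ => v.im + t) (𝓝 0) (𝓝 v.im) := by
        have : Continuous fun t : ℝ => v.im + t := by fun_prop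
        simpa using this.tendsto 0
      exact this.eventually_ne h
  obtain ⟨t, ⟨htU, htb⟩, ht⟩ := ((hev.filter_mono nhdsWithin_le_nhds).and hne).exists
  refine ⟨v + t * Complex.I, htU, ?_⟩
  have := hnonreal (-(v + t * Complex.I))
    (by rw [norm_neg]; exact mem_ball_zero_iff.1 htb) (by
    simpa [neg_add_eq_zero, add_eq_zero_iff_eq_neg, eq_comm] using ht)
  rwa [neg_neg] at this

theorem limitSet_subset_Phi :
    closure (Metric.ball (0 : ℂ) 1) ∪ -(zeroSet (Set.Icc (0 : ℝ) 1))⁻¹ ⊆ Phi E₁ :=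
  Set.union_subset (closure_minimal ball_subset_Phi isClosed_closure) neg_inv_zeroSet_subset_Phi

/-! ### Comparison of the three closures -/

theorem Phi_subset_PhiHat (E : ℕ → Fin 2) : Phi E ⊆ PhiHat E :=
  closure_mono fun _ ⟨β, hβ, hz⟩ => ⟨β, hβ.1, hz⟩

theorem Phi_subset_PhiStar : Phi E₁ ⊆ PhiStar E₁ :=
  closure_mono fun γ ⟨β, hβ, hγ⟩ => ⟨β, hβ.1.1, γ⁻¹, isZeroOf_inv_galoisConjugate hβ hγ,
    fun h => hγ.2 (inv_injective h), (inv_inv γ).symm⟩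

theorem PhiHat_subset_limitSet :
    PhiHat E₁ ⊆ closure (Metric.ball (0 : ℂ) 1) ∪ -(zeroSet (Set.Icc (0 : ℝ) 1))⁻¹ :=
  closure_minimal (fun _ ⟨_, hβ, hγ⟩ => galoisConjugate_mem_limitSet hβ hγ) isClosed_limitSet

theorem PhiStar_subset_limitSet :
    PhiStar E₁ ⊆ closure (Metric.ball (0 : ℂ) 1) ∪ -(zeroSet (Set.Icc (0 : ℝ) 1))⁻¹ := by
  refine closure_minimal ?_ isClosed_limitSet
  rintro _ ⟨β, hβ, z, hz, hzβ, rfl⟩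
  exact inv_zero_mem_limitSet hβ hz hzβ

end GenBeta

theorem theorem2p3 :
    GenBeta.Phi GenBeta.E₁ = GenBeta.PhiHat GenBeta.E₁ ∧
    GenBeta.PhiHat GenBeta.E₁ = GenBeta.PhiStar GenBeta.E₁ ∧
    GenBeta.PhiStar GenBeta.E₁ =
      closure (Metric.ball (0 : ℂ) 1) ∪ -(GenBeta.zeroSet (Set.Icc (0 : ℝ) 1))⁻¹ := by
  have hPhi := GenBeta.limitSet_subset_Phi
  have hHat := GenBeta.PhiHat_subset_limitSet
  have hStar := GenBeta.PhiStar_subset_limitSet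
  have hPH := GenBeta.Phi_subset_PhiHat GenBeta.E₁
  have hPS := GenBeta.Phi_subset_PhiStar
  exact ⟨hPH.antisymm (hHat.trans hPhi),
    ((hHat.trans hPhi).trans hPS).antisymm ((hStar.trans hPhi).trans hPH),
    hStar.antisymm (hPhi.trans hPS)⟩
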